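/- Let $0\le k\le n$ and let $\lambda$ be a partition whose Young diagram (English notation) fits in a $k\times(n-k)$ rectangle. Label the $n$ unit steps of the south-east border of $\lambda$ (a lattice path from the north-east to the south-west corner of the rectangle) by $1,\dots,n$. **Pipe dreams.** A pipe dream on $\lambda$ fills each cell with a crossing (joining its left and right edges, and its top and bottom edges) or an elbow tile (joining left with bottom, and top with right). This gives $n$ pipes between the south-east border and the north-west border (the west and north sides of the rectangle); each pipe has the label of its end on the south-east border. Let $\pi(E)$ be the permutation obtained by reading the labels of the pipes along the north-west border of a pipe dream $E$, first along the north side from right to left and then along the west side from top to bottom. In a given cell, the two pipes are *inverted* if the pipe on the right edge has a larger label than the pipe on the bottom edge. A crossing with non-inverted pipes is a *white stone*. A pipe dream $D$ is a *Go-diagram* if no elbow tile of $D$ has inverted pipes. **The matrix $R_D$.** Let $D$ be a Go-diagram on $\lambda$, and let $\beta_b$ be a parameter, for each cell $b$ of $\lambda$, in a commutative ring (for instance $\mathbb R$ or $\mathbb C$). A *restricted path* starts on the north-west border, travels along the pipes of $D$ to the south-east border, and in every cell that it enters either stays on its pipe or, if the cell is not a white stone, may jump to the other pipe in the cell, provided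 that pipe has a smaller label. Its weight is the product of the $\beta_b$ over the cells $b$ at which it jumps. Let $R_D$ be the $k\times n$ matrix whose $(s,t)$ entry is the sum of the weights of all restricted paths from the $s$-th edge (from the top) of the west side to the edge labelled $t$ of the south-east border. For $I\subseteq\{1,\dots,n\}$ with $|I|=k$, let $\Delta_I(R_D)$ be the maximal minor of $R_D$ with columns $I$ in increasing order. **Restricted diagrams.** Toggling a cell means exchanging crossing and elbow tile there. Let $\mathfrak D(D)$ be the set of all pipe dreams $E$ for which there is a sequence $D=E_0,E_1,\dots,E_r=E$ ($r\ge 0$) in which each $E_{i+1}$ arises from $E_i$ by toggling a cell $p$ such that: $p$ is not a white stone of $D$; toggling $p$ in $E_i$ swaps a label on the west side with a label on the north side; toggling $p$ increases the length (number of inversions) of the permutation, i.e. $\ell(\pi(E_{i+1}))>\ell(\pi(E_i))$; and no cell weakly south-east of $p$ (including $p$ itself) has been toggled before. Thus the toggled cells of $E$ are those at which $E$ and $D$ differ; let $\mathrm{wt}(E)$ be the product of $\beta_b$ over the toggled cells $b$ of $E$. Let $(p_1,\dots,p_k)$ be the labels of the pipes of $E$ on the west side from top to bottom, let $I_E=\{p_1,\dots,p_k\}$,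 and let $\pi_E$ be the permutation of $\{1,\dots,k\}$ with $p_{\pi_E(1)}\le\dots\le p_{\pi_E(k)}$. **Theorem.** For every Go-diagram $D$ on $\lambda$ and every $I\subseteq\{1,\dots,n\}$ with $|I|=k$, $$\Delta_I(R_D)=\sum_{\substack{E\in\mathfrak D(D)\\ I_E=I}}\operatorname{sign}(\pi_E)\,\mathrm{wt}(E).$$ -/

import Mathlib

/-- A partition in `Λ_{k,n}`: a Young diagram (English notation) that fits inside the
`k × (n - k)` rectangle.  The cell in row `i` and column `j` is `(i, j)`, both counted from `0`. -/
structure BoxPartition (k n : ℕ) where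
  diagram : YoungDiagram
  row_lt : ∀ c ∈ diagram.cells, c.1 < k
  col_lt : ∀ c ∈ diagram.cells, c.2 < n - k

namespace BoxPartition

variable {k n : ℕ}

/-- The cells of `lam`. -/
abbrev Cell (lam : BoxPartition k n) : Type := {c : ℕ × ℕ // c ∈ lam.diagram.cells}

end BoxPartition

/-- A unit edge of the grid: `left i j` is the left edge of the square `(i, j)` and `top i j` is its
top edge.  So the right edge of `(i, j)` is `left i (j + 1)` and its bottom edge is
`top (i + 1) j`. -/
inductive GridEdge : Type
  | left (i j : ℕ)
  | top (i j : ℕ)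

namespace GridEdge

/-- The square lying directly to the right of, or directly below, the edge. -/
def square : GridEdge → ℕ × ℕ
  | left i j => (i, j)
  | top i j => (i, j)

/-- The position (from `0`) of an edge of a lattice path from the north-east to the south-west
corner of a box with `m` columns.  For the edges of the south-east border of a partition these are
the labels of that border, with `0, …, n - 1` in place of `1, …, n`. -/
def position (m : ℕ) : GridEdge → ℕ
  | left i j => m - j + i
  | top i j => m - (j + 1) + i

/-- The edge lies in the `k × m` box. -/
def InBox (k m : ℕ) : GridEdge → Prop
  | left i j => i < k ∧ j ≤ m
  | top i j => i ≤ k ∧ j < m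

theorem position_lt {k m : ℕ} {e : GridEdge} (he : e.InBox k m) : e.position m < m + k := by
  cases e <;> simp only [InBox, position] at * <;> omega

end GridEdge

/-- A pipe dream on `lam`, that is, a `(+, ∘)` filling of `lam`, given by the set of the cells that
carry a crossing (`∘`); all other cells carry an elbow tile (`+`). -/
abbrev PipeDream {k n : ℕ} (lam : BoxPartition k n) : Type := Finset lam.Cell

namespace PipeDream

variable {k n : ℕ} {lam : BoxPartition k n}

/-- The square `c` is a cell of `lam` that carries a crossing. -/
def IsCrossing (E : PipeDream lam) (c : ℕ × ℕ) : Prop :=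
  ∃ h : c ∈ lam.diagram.cells, (⟨c, h⟩ : lam.Cell) ∈ E

instance (E : PipeDream lam) (c : ℕ × ℕ) : Decidable (E.IsCrossing c) := by
  unfold IsCrossing; infer_instance

/-- Travelling from the north-west to the south-east border, a pipe enters the square
`e.square` through its left or top edge `e`.  `E.next e` is the edge through which it leaves the
square: a crossing joins left with right and top with bottom, an elbow tile joins left with bottom
and top with right. -/
def next (E : PipeDream lam) : GridEdge → GridEdge
  | .left i j => if E.IsCrossing (i, j) then .left i (j + 1) else .top (i + 1) j
  | .top i j => if E.IsCrossing (i, j) then .top (i + 1) j else .left i (j + 1)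

/-- The other one of the right and bottom edges of the square `e.square`; the pipe on that edge is
the other pipe through the square. -/
def other (E : PipeDream lam) : GridEdge → GridEdge
  | .left i j => if E.IsCrossing (i, j) then .top (i + 1) j else .left i (j + 1)
  | .top i j => if E.IsCrossing (i, j) then .left i (j + 1) else .top (i + 1) j

theorem sum_square_next (E : PipeDream lam) (e : GridEdge) :
    (E.next e).square.1 + (E.next e).square.2 = e.square.1 + e.square.2 + 1 := by
  cases e <;> simp only [next] <;> split_ifs <;> simp only [GridEdge.square] <;> omega

theorem inBox_next (E : PipeDream lam) {e : GridEdge} (he : e.square ∈ lam.diagram.cells) :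
    (E.next e).InBox k (n - k) := by
  have h1 := lam.row_lt _ he
  have h2 := lam.col_lt _ he
  cases e <;> simp only [next] <;> split_ifs <;>
    simp only [GridEdge.square, GridEdge.InBox] at * <;> omega

/-- The label of the pipe that runs through the edge `e`: follow the pipe to the south-east border
and read off the label there. -/
def label (E : PipeDream lam) (e : GridEdge) : ℕ :=
  if e.square ∈ lam.diagram.cells then E.label (E.next e) else e.position (n - k)
termination_by k + (n - k) - (e.square.1 + e.square.2)
decreasing_by
  have h1 := lam.row_lt _ ‹_›
  have h2 := lam.col_lt _ ‹_›
  have h3 := sum_square_next E e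
  omega

theorem label_lt (E : PipeDream lam) (e : GridEdge) (he : e.InBox k (n - k)) (hkn : k ≤ n) :
    E.label e < n := by
  rw [label]
  split_ifs with h
  · exact E.label_lt (E.next e) (E.inBox_next h) hkn
  · have := GridEdge.position_lt he
    omega
termination_by k + (n - k) - (e.square.1 + e.square.2)
decreasing_by
  have h1 := lam.row_lt _ ‹_›
  have h2 := lam.col_lt _ ‹_›
  have h3 := sum_square_next E e
  omega

/-- The pipes that meet at the cell `c` are inverted (the configurations `B` and `D`): the pipe on
the right edge of `c` has a larger label than the pipe on its bottom edge. -/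
def Inverted (E : PipeDream lam) (c : lam.Cell) : Prop :=
  E.label (.top (c.1.1 + 1) c.1.2) < E.label (.left c.1.1 (c.1.2 + 1))

/-- A pipe dream is a Go-diagram if no elbow tile carries inverted pipes (configuration `B`). -/
def IsGoDiagram (D : PipeDream lam) : Prop :=
  ∀ c : lam.Cell, c ∉ D → ¬ D.Inverted c

/-- A white stone (configuration `C`): a crossing at which the pipes are not inverted.  The other
crossings (configuration `D`) are the black stones. -/
def WhiteStone (D : PipeDream lam) (c : lam.Cell) : Prop :=
  c ∈ D ∧ ¬ D.Inverted c

/-- Restricted paths on the pipe dream of `D` from the edge `e` to the sink labelled `t` on the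
south-east border.  In each cell that it enters, the path follows the pipe it is on or, if the cell
is not a white stone, jumps to the other pipe in that cell, provided the latter has a smaller
label. -/
inductive RestrictedPath (D : PipeDream lam) (t : ℕ) : GridEdge → Type
  | arrive {e : GridEdge} (h : e.square ∉ lam.diagram.cells) (ht : e.position (n - k) = t) :
      RestrictedPath D t e
  | follow {e : GridEdge} (h : e.square ∈ lam.diagram.cells)
      (P : RestrictedPath D t (D.next e)) : RestrictedPath D t e
  | jump {e : GridEdge} (h : e.square ∈ lam.diagram.cells)
      (hw : ¬ D.WhiteStone ⟨e.square, h⟩) (hl : D.label (D.other e) < D.label e)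
      (P : RestrictedPath D t (D.other e)) : RestrictedPath D t e

/-- The weight of a restricted path: the product of the jump parameters `β` at its jump sites. -/
def RestrictedPath.weight {R : Type*} [CommRing R] {D : PipeDream lam} {t : ℕ}
    (β : lam.Cell → R) : {e : GridEdge} → RestrictedPath D t e → R
  | _, .arrive _ _ => 1
  | _, .follow _ P => P.weight β
  | e, .jump h _ _ P => β ⟨e.square, h⟩ * P.weight β

theorem sum_square_other (E : PipeDream lam) (e : GridEdge) :
    (E.other e).square.1 + (E.other e).square.2 = e.square.1 + e.square.2 + 1 := by
  cases e <;> simp only [other] <;> split_ifs <;> simp only [GridEdge.square] <;> omega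

/-- There are only finitely many restricted paths from a given edge to a given sink. -/
instance RestrictedPath.finite (D : PipeDream lam) (t : ℕ) (e : GridEdge) :
    Finite (RestrictedPath D t e) := by
  by_cases h : e.square ∈ lam.diagram.cells
  · have h1 := lam.row_lt _ h
    have h2 := lam.col_lt _ h
    have h3 := sum_square_next D e
    have h4 := sum_square_other D e
    have := RestrictedPath.finite D t (D.next e)
    have := RestrictedPath.finite D t (D.other e)
    let f : RestrictedPath D t e →
        RestrictedPath D t (D.next e) ⊕ RestrictedPath D t (D.other e) := fun P =>
      match P with
      | .arrive h' _ => absurd h h'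
      | .follow _ P => Sum.inl P
      | .jump _ _ _ P => Sum.inr P
    refine Finite.of_injective f ?_
    intro P Q hPQ
    cases P <;> cases Q <;> first | contradiction | simp_all [f]
  · have : Subsingleton (RestrictedPath D t e) := ⟨by
      intro P Q
      cases P <;> cases Q <;> first | rfl | contradiction⟩
    infer_instance
termination_by k + (n - k) - (e.square.1 + e.square.2)
decreasing_by all_goals omega

/-- The `k × n` matrix `R_D`.  Its entry in row `s` and column `t` is the sum of the weights of all
restricted paths from the source at the left edge of row `s` of the box to the sink labelled `t`. -/
noncomputable def restrictedPathMatrix {R : Type*} [CommRing R] (D : PipeDream lam)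
    (β : lam.Cell → R) : Matrix (Fin k) (Fin n) R :=
  fun s t => ∑ᶠ P : RestrictedPath D (t : ℕ) (.left (s : ℕ) 0), P.weight β

/-- The word `π(E)`: the labels of the pipes on the north-west border, first the top border from
right to left and then the west border from top to bottom. -/
def word (E : PipeDream lam) (a : Fin n) : ℕ :=
  if (a : ℕ) < n - k then E.label (.top 0 (n - k - 1 - a)) else E.label (.left (a - (n - k)) 0)

/-- The length of the permutation `π(E)`, that is, its number of inversions. -/
def length (E : PipeDream lam) : ℕ :=
  (Finset.univ.filter fun x : Fin n × Fin n => x.1 < x.2 ∧ E.word x.2 < E.word x.1).card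

/-- The diagram obtained from `E` by toggling the cell `p`. -/
def toggle (E : PipeDream lam) (p : lam.Cell) : PipeDream lam :=
  symmDiff E {p}

/-- The toggled cells of a diagram `E` obtained from `D`: the cells at which `E` and `D` differ.
(By the third condition in `Togglable` no cell is ever toggled twice, see
`toggledCells_toggle`.) -/
def toggledCells (D E : PipeDream lam) : Finset lam.Cell :=
  symmDiff D E

/-- The cell `p` of the diagram `E`, obtained from `D` by toggling, is togglable. -/
structure Togglable (D E : PipeDream lam) (p : lam.Cell) : Prop where
  /-- White stones of `D` are untogglable. -/
  not_white : ¬ D.WhiteStone p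
  /-- Toggling swaps the label of a pipe on the west border with one on the north border. -/
  swap : ∃ i < k, ∃ j < n - k,
    (E.toggle p).label (.left i 0) = E.label (.top 0 j) ∧
      (E.toggle p).label (.top 0 j) = E.label (.left i 0)
  /-- Toggling increases the length of the permutation. -/
  length_lt : E.length < (E.toggle p).length
  /-- There is no toggled cell weakly south-east of `p`. -/
  not_toggled : ∀ q ∈ toggledCells D E, ¬ (p.1.1 ≤ q.1.1 ∧ p.1.2 ≤ q.1.2)

theorem toggledCells_self (D : PipeDream lam) : toggledCells D D = ∅ := by
  simp [toggledCells]

theorem toggledCells_toggle {D E : PipeDream lam} {p : lam.Cell} (h : Togglable D E p) :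
    toggledCells D (E.toggle p) = insert p (toggledCells D E) := by
  have hp : p ∉ toggledCells D E := fun hp => h.not_toggled p hp ⟨le_rfl, le_rfl⟩
  ext q
  by_cases hq : q = p
  · subst hq
    simp only [toggledCells, toggle, Finset.mem_symmDiff, Finset.mem_singleton,
      Finset.mem_insert] at *
    tauto
  · simp only [toggledCells, toggle, Finset.mem_symmDiff, Finset.mem_singleton,
      Finset.mem_insert] at *
    tauto

/-- `E` is a restricted diagram obtained from `D`: there is a sequence `D = E_0, E_1, …, E_r = E` in
which each term arises from the previous one by toggling a togglable cell. -/
inductive IsRestrictedDiagram (D : PipeDream lam) : PipeDream lam → Prop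
  | base : IsRestrictedDiagram D D
  | step {E : PipeDream lam} {p : lam.Cell} (hE : IsRestrictedDiagram D E)
      (hp : Togglable D E p) : IsRestrictedDiagram D (E.toggle p)

open Classical in
/-- The set `𝔇(D)` of all restricted diagrams obtained from `D`. -/
noncomputable def restrictedDiagrams (D : PipeDream lam) : Finset (PipeDream lam) :=
  Finset.univ.filter fun E => IsRestrictedDiagram D E

/-- The labels `(p_1, …, p_k)` of the pipes on the west border, from top to bottom. -/
def westLabels (hkn : k ≤ n) (E : PipeDream lam) (s : Fin k) : Fin n :=
  ⟨E.label (.left s 0), E.label_lt _ ⟨s.2, Nat.zero_le _⟩ hkn⟩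

/-- The set `I_E` of the labels of the pipes on the west border. -/
def westSet (hkn : k ≤ n) (E : PipeDream lam) : Finset (Fin n) :=
  Finset.univ.image (E.westLabels hkn)

/-- The permutation `π_E` that sorts the labels on the west border:
`p_{π_E(1)} ≤ … ≤ p_{π_E(k)}`. -/
def sortPerm (hkn : k ≤ n) (E : PipeDream lam) : Equiv.Perm (Fin k) :=
  Tuple.sort (E.westLabels hkn)

/-- The weight of a restricted diagram `E` of `D`: the product of the jump parameters at the
toggled cells. -/
def diagramWeight {R : Type*} [CommRing R] (D : PipeDream lam) (β : lam.Cell → R)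
    (E : PipeDream lam) : R :=
  ∏ p ∈ toggledCells D E, β p

end PipeDream

/-- The Plücker coordinate `Δ_I(A)`: the maximal minor of `A` with columns `I` (in increasing
order). -/
def pluckerCoordinate {R : Type*} [CommRing R] {k n : ℕ} (A : Matrix (Fin k) (Fin n) R)
    (I : Finset (Fin n)) (hI : I.card = k) : R :=
  (A.submatrix id (I.orderEmbOfFin hI)).det

/-! Jump parameters are switched on one cell at a time. In a Go-diagram the pipe entering a cell
from the left has a larger label than the one entering from the top, unless the cell is a white
stone (`IsGoDiagram.label_top_lt_label_left`). Hence restricted paths jump exactly from left pipes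
to top pipes, and `R_D` is a matrix of path sums (`pathSum`) with `β` replaced by 0 at white stones.
In this form jumps no longer refer to labels, and the diagram can vary.

Suppose no jumps are allowed weakly north-west of `c`. Switching on the parameter at `c` changes at
most the row whose pipe enters `c` from the left: it gains a multiple of the path sums from the top
edge of `c`. By multilinearity the determinant gains one term (`det_pathSumMatrix_of_eq_off`). If
the top pipe also starts on the west border, this term has two equal rows and vanishes; if it starts
on the north border, the term is a multiple of the determinant for the diagram with `c` toggled.
Iteration gives a sum over toggle sets (`det_pathSumMatrix_eq_sum`) of products of parameters times
determinants of jump-free 0/1 matrices, which are signs or 0 (`det_pathSumMatrix_zero`).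

It remains to identify toggle sets without white stones with restricted diagrams. When nothing
weakly south-east of `p` has been toggled, the two labels at `p` are those in `D`, so togglability
means that the left pipe starts on the west and the top pipe on the north border (`togglable_iff`).
This depends only on cells strictly north-west of `p`, so it can be read off the final diagram. -/

namespace GridEdge

/-! ### Edges and positions on the south-east border -/

/-- The antidiagonal on which the square of an edge lies. -/
def level (e : GridEdge) : ℕ := e.square.1 + e.square.2

/-- The edge lies on the north-west border, or the square before it is a cell of `lam`. -/
def Reached {k n : ℕ} (lam : BoxPartition k n) : GridEdge → Prop
  | left i j => i < k ∧ (j = 0 ∨ (i, j - 1) ∈ lam.diagram.cells)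
  | top i j => j < n - k ∧ (i = 0 ∨ (i - 1, j) ∈ lam.diagram.cells)

/-- Of two distinct edges with the same position, one lies further south-east. The cell preceding it
then forces the square of the other edge into `lam`, because a Young diagram is closed to the
north-west. -/
theorem position_injOn {k n : ℕ} {lam : BoxPartition k n} {e f : GridEdge}
    (he : e.Reached lam) (hf : f.Reached lam) (he' : e.square ∉ lam.diagram.cells)
    (hf' : f.square ∉ lam.diagram.cells) (h : e.position (n - k) = f.position (n - k)) :
    e = f := by
  have hlow : ∀ {a b c d : ℕ}, (c, d) ∈ lam.diagram.cells → a ≤ c → b ≤ d →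
      (a, b) ∈ lam.diagram.cells := fun h h1 h2 => lam.diagram.up_left_mem h1 h2 h
  have hcol : ∀ {c d : ℕ}, (c, d) ∈ lam.diagram.cells → d < n - k := fun h => lam.col_lt _ h
  rcases e with ⟨i, j⟩ | ⟨i, j⟩ <;> rcases f with ⟨i', j'⟩ | ⟨i', j'⟩ <;>
    simp only [Reached, square, position] at *
  · have hj : j ≤ n - k := by
      rcases he.2 with h | h
      · omega
      · have := hcol h; omega
    have hj' : j' ≤ n - k := by
      rcases hf.2 with h | h
      · omega
      · have := hcol h; omega
    rcases lt_trichotomy i i' with hi | hi | hi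
    · rcases hf.2 with h0 | h0
      · omega
      · exact absurd (hlow h0 hi.le (by omega)) he'
    · simp only [left.injEq]; omega
    · rcases he.2 with h0 | h0
      · omega
      · exact absurd (hlow h0 hi.le (by omega)) hf'
  · have hj : j ≤ n - k := by
      rcases he.2 with h | h
      · omega
      · have := hcol h; omega
    rcases lt_or_ge i i' with hi | hi
    · rcases hf.2 with h0 | h0
      · omega
      · exact absurd (hlow h0 (by omega) (by omega)) he'
    · rcases he.2 with h0 | h0
      · omega
      · exact absurd (hlow h0 hi (by omega)) hf'
  · have hj' : j' ≤ n - k := by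
      rcases hf.2 with h | h
      · omega
      · have := hcol h; omega
    rcases lt_or_ge i' i with hi | hi
    · rcases he.2 with h0 | h0
      · omega
      · exact absurd (hlow h0 (by omega) (by omega)) hf'
    · rcases hf.2 with h0 | h0
      · omega
      · exact absurd (hlow h0 hi (by omega)) he'
  · rcases lt_trichotomy i i' with hi | hi | hi
    · rcases hf.2 with h0 | h0
      · omega
      · exact absurd (hlow h0 (by omega) (by omega)) he'
    · simp only [top.injEq]; omega
    · rcases he.2 with h0 | h0
      · omega
      · exact absurd (hlow h0 (by omega) (by omega)) hf'

end GridEdge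

namespace PipeDream

open GridEdge

variable {k n : ℕ} {lam : BoxPartition k n}

/-! ### Pipes: origins on the north-west border, labels on the south-east border -/

/-- The induction principle that follows the pipes towards the south-east border. -/
theorem southEast_induction (lam : BoxPartition k n) {P : GridEdge → Prop}
    (out : ∀ e : GridEdge, e.square ∉ lam.diagram.cells → P e)
    (cell : ∀ e : GridEdge, e.square ∈ lam.diagram.cells →
      (∀ f : GridEdge, f.level = e.level + 1 → e.square ≤ f.square → P f) → P e)
    (e : GridEdge) : P e := by
  by_cases h : e.square ∈ lam.diagram.cells
  · exact cell e h fun f _ _ => southEast_induction lam out cell f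
  · exact out e h
termination_by k + (n - k) - e.level
decreasing_by
  have h1 := lam.row_lt _ h
  have h2 := lam.col_lt _ h
  simp only [level] at *
  omega

theorem level_next (E : PipeDream lam) (e : GridEdge) : (E.next e).level = e.level + 1 :=
  E.sum_square_next e

theorem level_other (E : PipeDream lam) (e : GridEdge) : (E.other e).level = e.level + 1 :=
  E.sum_square_other e

theorem square_le_next (E : PipeDream lam) (e : GridEdge) : e.square ≤ (E.next e).square := by
  cases e <;> simp only [next] <;> split_ifs <;> simp [square, Prod.le_def]

theorem reached_next (E : PipeDream lam) {e : GridEdge} (he : e.square ∈ lam.diagram.cells) :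
    (E.next e).Reached lam := by
  have h1 := lam.row_lt _ he
  have h2 := lam.col_lt _ he
  cases e <;> simp only [next] <;> split_ifs <;> simp_all [square, Reached]

theorem label_of_mem (E : PipeDream lam) {e : GridEdge} (he : e.square ∈ lam.diagram.cells) :
    E.label e = E.label (E.next e) := by
  rw [label, if_pos he]

theorem label_of_notMem (E : PipeDream lam) {e : GridEdge} (he : e.square ∉ lam.diagram.cells) :
    E.label e = e.position (n - k) := by
  rw [label, if_neg he]

/-- The edge of the north-west border at which the pipe through an edge starts. -/
def origin (E : PipeDream lam) : GridEdge → GridEdge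
  | .left i 0 => .left i 0
  | .top 0 j => .top 0 j
  | .left i (j + 1) => if E.IsCrossing (i, j) then E.origin (.left i j) else E.origin (.top i j)
  | .top (i + 1) j => if E.IsCrossing (i, j) then E.origin (.top i j) else E.origin (.left i j)
termination_by e => e.square.1 + e.square.2
decreasing_by all_goals simp only [GridEdge.square]; omega

theorem origin_next (E : PipeDream lam) (e : GridEdge) : E.origin (E.next e) = E.origin e := by
  rcases e with ⟨i, j⟩ | ⟨i, j⟩ <;> simp only [next] <;> split_ifs with h <;>
    (conv_lhs => rw [origin]) <;> simp [h]

/-- The number of steps is the difference of levels, so an edge is determined by its origin and its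
level. Squares outside `lam` behave as elbows here, hence no membership hypothesis. -/
theorem eq_iterate_next_origin (E : PipeDream lam) (e : GridEdge) :
    ∃ m, e = E.next^[m] (E.origin e) ∧ e.level = (E.origin e).level + m := by
  have key : ∀ f : GridEdge, E.origin (E.next f) = E.origin f →
      (∃ m, f = E.next^[m] (E.origin f) ∧ f.level = (E.origin f).level + m) →
      ∃ m, E.next f = E.next^[m] (E.origin (E.next f)) ∧
        (E.next f).level = (E.origin (E.next f)).level + m := by
    rintro f hf ⟨m, h1, h2⟩
    refine ⟨m + 1, ?_, ?_⟩
    · rw [hf, Function.iterate_succ_apply', ← h1]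
    · rw [hf, level_next, h2]; ring
  have ind : ∀ N, ∀ e : GridEdge, e.level = N →
      ∃ m, e = E.next^[m] (E.origin e) ∧ e.level = (E.origin e).level + m := by
    intro N
    induction N with
    | zero =>
      intro e he
      rcases e with ⟨i, j⟩ | ⟨i, j⟩ <;> simp only [level, square] at he <;>
        obtain ⟨rfl, rfl⟩ : i = 0 ∧ j = 0 := by omega
      all_goals exact ⟨0, by simp [origin]⟩
    | succ N ih =>
      intro e he
      rcases e with ⟨i, _ | j⟩ | ⟨_ | i, j⟩
      · exact ⟨0, by simp [origin]⟩
      · by_cases h : E.IsCrossing (i, j)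
        · have := key (.left i j) (E.origin_next _) (ih _ (by simp [level, square] at *; omega))
          simpa only [next, if_pos h] using this
        · have := key (.top i j) (E.origin_next _) (ih _ (by simp [level, square] at *; omega))
          simpa only [next, if_neg h] using this
      · exact ⟨0, by simp [origin]⟩
      · by_cases h : E.IsCrossing (i, j)
        · have := key (.top i j) (E.origin_next _) (ih _ (by simp [level, square] at *; omega))
          simpa only [next, if_pos h] using this
        · have := key (.left i j) (E.origin_next _) (ih _ (by simp [level, square] at *; omega))
          simpa only [next, if_neg h] using this
  exact ind _ e rfl

/-- A pipe meets each antidiagonal at most once. -/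
theorem eq_of_origin_eq (E : PipeDream lam) {e f : GridEdge} (hl : e.level = f.level)
    (h : E.origin e = E.origin f) : e = f := by
  obtain ⟨m, h1, h2⟩ := E.eq_iterate_next_origin e
  obtain ⟨m', h1', h2'⟩ := E.eq_iterate_next_origin f
  rw [h] at h1 h2
  obtain rfl : m = m' := by omega
  rw [h1, ← h1']

/-- A function that is constant along the steps of the pipe before `e` has the same value at the
start of the pipe as at `e`. -/
theorem apply_origin {α : Type*} (E : PipeDream lam) (f : GridEdge → α) {e : GridEdge}
    (he : e.Reached lam)
    (h : ∀ e' : GridEdge, e'.square ∈ lam.diagram.cells → e'.square ≤ e.square →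
      e'.level < e.level → f (E.next e') = f e') :
    f (E.origin e) = f e := by
  have step : ∀ {c d : ℕ}, (c, d) ∈ lam.diagram.cells →
      (GridEdge.left c d).Reached lam ∧ (GridEdge.top c d).Reached lam := by
    intro c d hc
    exact ⟨⟨lam.row_lt _ hc, Or.inr (lam.diagram.up_left_mem le_rfl (Nat.sub_le _ _) hc)⟩,
      ⟨lam.col_lt _ hc, Or.inr (lam.diagram.up_left_mem (Nat.sub_le _ _) le_rfl hc)⟩⟩
  have ind : ∀ N, ∀ e' : GridEdge, e'.level = N → e'.Reached lam → e'.square ≤ e.square →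
      f (E.origin e') = f e' := by
    intro N
    induction N with
    | zero =>
      intro e he _ _
      rcases e with ⟨i, j⟩ | ⟨i, j⟩ <;> simp only [level, square] at he <;>
        obtain ⟨rfl, rfl⟩ : i = 0 ∧ j = 0 := by omega
      all_goals simp [origin]
    | succ N ih =>
      have main : ∀ e' : GridEdge, (E.next e').level = N + 1 → (E.next e').square ≤ e.square →
          e'.square ∈ lam.diagram.cells → f (E.origin (E.next e')) = f (E.next e') := by
        intro e' h1 h2 h3
        have h4 := (E.square_le_next e').trans h2
        have h6 : (E.next e').level ≤ e.level := add_le_add h2.1 h2.2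
        rw [level_next] at h1 h6
        rw [origin_next, h e' h3 h4 (by omega)]
        refine ih e' (by omega) ?_ h4
        rcases e' with ⟨a, b⟩ | ⟨a, b⟩
        · exact (step h3).1
        · exact (step h3).2
      intro e' h1 h2 h3
      rcases e' with ⟨i, _ | j⟩ | ⟨_ | i, j⟩
      · simp [origin]
      · have h5 : (i, j) ∈ lam.diagram.cells := by simpa [Reached] using h2.2
        by_cases hc : E.IsCrossing (i, j)
        · have := main (.left i j)
          simp only [next, if_pos hc] at this
          exact this h1 h3 h5
        · have := main (.top i j)
          simp only [next, if_neg hc] at this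
          exact this h1 h3 h5
      · simp [origin]
      · have h5 : (i, j) ∈ lam.diagram.cells := by simpa [Reached] using h2.2
        by_cases hc : E.IsCrossing (i, j)
        · have := main (.top i j)
          simp only [next, if_pos hc] at this
          exact this h1 h3 h5
        · have := main (.left i j)
          simp only [next, if_neg hc] at this
          exact this h1 h3 h5
  exact ind _ e rfl he le_rfl

theorem label_origin (E : PipeDream lam) {e : GridEdge} (he : e.Reached lam) :
    E.label (E.origin e) = E.label e :=
  E.apply_origin E.label he fun _ h _ _ => (E.label_of_mem h).symm

theorem origin_isBorder (E : PipeDream lam) : ∀ e : GridEdge,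
    (∃ i, E.origin e = .left i 0) ∨ ∃ j, E.origin e = .top 0 j
  | .left i 0 => by simp [origin]
  | .top 0 j => by simp [origin]
  | .left i (j + 1) => by
    rw [origin]
    split_ifs
    exacts [E.origin_isBorder _, E.origin_isBorder _]
  | .top (i + 1) j => by
    rw [origin]
    split_ifs
    exacts [E.origin_isBorder _, E.origin_isBorder _]
termination_by e => e.square.1 + e.square.2
decreasing_by all_goals simp only [GridEdge.square]; omega

theorem exists_sink (E : PipeDream lam) (e : GridEdge) : e.Reached lam →
    ∃ s : GridEdge, s.Reached lam ∧ s.square ∉ lam.diagram.cells ∧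
      E.label e = s.position (n - k) ∧ E.origin s = E.origin e := by
  induction e using southEast_induction lam with
  | out e h => exact fun he => ⟨e, he, h, E.label_of_notMem h, rfl⟩
  | cell e h ih =>
    intro _
    obtain ⟨s, h1, h2, h3, h4⟩ :=
      ih (E.next e) (E.level_next e) (E.square_le_next e) (E.reached_next h)
    exact ⟨s, h1, h2, by rw [E.label_of_mem h, h3], by rw [h4, origin_next]⟩

/-- The label determines the sink by `position_injOn`, and the sink determines the pipe. Distinct
pipes therefore have distinct labels. -/
theorem origin_eq_of_label_eq (E : PipeDream lam) {e f : GridEdge} (he : e.Reached lam)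
    (hf : f.Reached lam) (h : E.label e = E.label f) : E.origin e = E.origin f := by
  obtain ⟨s, h1, h2, h3, h4⟩ := E.exists_sink e he
  obtain ⟨s', h1', h2', h3', h4'⟩ := E.exists_sink f hf
  rw [← h4, ← h4', position_injOn h1 h1' h2 h2' (by rw [← h3, ← h3', h])]

theorem label_congr {E E' : PipeDream lam} (e : GridEdge) :
    (∀ q : lam.Cell, e.square ≤ q.1 → (q ∈ E ↔ q ∈ E')) → E.label e = E'.label e := by
  induction e using southEast_induction lam with
  | out e h => intro _; rw [E.label_of_notMem h, E'.label_of_notMem h]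
  | cell e h ih =>
    intro hq
    have hn : E.next e = E'.next e := by
      have hc : E.IsCrossing e.square ↔ E'.IsCrossing e.square :=
        exists_congr fun h => hq ⟨_, h⟩ le_rfl
      rcases e with ⟨i, j⟩ | ⟨i, j⟩ <;> simp only [next, square] at * <;> simp only [hc]
    rw [E.label_of_mem h, E'.label_of_mem h, ← hn]
    exact ih _ (E.level_next e) (E.square_le_next e)
      fun q h' => hq q ((E.square_le_next e).trans h')

/-- Complements `label_congr`: origins look strictly north-west, labels weakly south-east. The order
of toggles rests on this contrast. -/
theorem origin_congr {E E' : PipeDream lam} : ∀ e : GridEdge,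
    (∀ q : lam.Cell, q.1 < e.square → (q ∈ E ↔ q ∈ E')) → E.origin e = E'.origin e
  | .left i 0, _ => by simp [origin]
  | .top 0 j, _ => by simp [origin]
  | .left i (j + 1), h => by
    have hlt : ((i, j) : ℕ × ℕ) < (i, j + 1) := by simp [Prod.lt_iff]
    have h1 : E.IsCrossing (i, j) ↔ E'.IsCrossing (i, j) := exists_congr fun h' => h ⟨_, h'⟩ hlt
    have h2 := origin_congr (E := E) (E' := E') (.left i j) fun q a => h q (a.trans hlt)
    have h3 := origin_congr (E := E) (E' := E') (.top i j) fun q a => h q (a.trans hlt)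
    rw [origin, origin]
    simp only [h1, h2, h3]
  | .top (i + 1) j, h => by
    have hlt : ((i, j) : ℕ × ℕ) < (i + 1, j) := by simp [Prod.lt_iff]
    have h1 : E.IsCrossing (i, j) ↔ E'.IsCrossing (i, j) := exists_congr fun h' => h ⟨_, h'⟩ hlt
    have h2 := origin_congr (E := E) (E' := E') (.left i j) fun q a => h q (a.trans hlt)
    have h3 := origin_congr (E := E) (E' := E') (.top i j) fun q a => h q (a.trans hlt)
    rw [origin, origin]
    simp only [h1, h2, h3]
termination_by e => e.square.1 + e.square.2
decreasing_by all_goals simp only [GridEdge.square]; omega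

end PipeDream

/-! ### Inversions under a transposition -/

/-- Swapping two values that are in order increases the number of inversions. -/
theorem card_inversions_lt_of_swap {n : ℕ} {w w' : Fin n → ℕ} {a b : Fin n} (hab : a < b)
    (hw : w a < w b) (h : ∀ x, w' x = w (Equiv.swap a b x)) :
    (Finset.univ.filter fun x : Fin n × Fin n => x.1 < x.2 ∧ w x.2 < w x.1).card <
      (Finset.univ.filter fun x : Fin n × Fin n => x.1 < x.2 ∧ w' x.2 < w' x.1).card := by
  set σ := Equiv.swap a b with hσ
  have hcases : ∀ x, (x = a ∧ σ x = b) ∨ (x = b ∧ σ x = a) ∨ (x ≠ a ∧ x ≠ b ∧ σ x = x) := by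
    intro x
    by_cases hxa : x = a
    · left; subst hxa; simp [hσ]
    · by_cases hxb : x = b
      · right; left; subst hxb; simp [hσ]
      · right; right; exact ⟨hxa, hxb, Equiv.swap_apply_of_ne_of_ne hxa hxb⟩
  have hinv : ∀ x, σ (σ x) = x := fun x => Equiv.swap_apply_self a b x
  -- Injection of inversions of `w` into those of `w'`: move both positions by the swap when this
  -- keeps them in order, otherwise leave the pair alone. The inversion `(a, b)` of `w'` is missed.
  let φ : Fin n × Fin n → Fin n × Fin n :=
    fun x => if σ x.1 < σ x.2 then (σ x.1, σ x.2) else x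
  have himg : Finset.image φ
      (Finset.univ.filter fun x : Fin n × Fin n => x.1 < x.2 ∧ w x.2 < w x.1) ⊂
      (Finset.univ.filter fun x : Fin n × Fin n => x.1 < x.2 ∧ w' x.2 < w' x.1) := by
    refine (Finset.ssubset_iff_of_subset ?_).2 ⟨(a, b), ?_, ?_⟩
    · intro z hz
      simp only [Finset.mem_image, Finset.mem_filter, Finset.mem_univ, true_and] at hz ⊢
      obtain ⟨⟨x, y⟩, ⟨h1, h2⟩, rfl⟩ := hz
      simp only [φ] at *
      split_ifs with hlt
      · simpa [h, hinv] using ⟨hlt, h2⟩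
      · refine ⟨h1, ?_⟩
        simp only [h]
        rcases hcases x with ⟨rfl, hx⟩ | ⟨rfl, hx⟩ | ⟨hxa, hxb, hx⟩ <;>
          rcases hcases y with ⟨rfl, hy⟩ | ⟨rfl, hy⟩ | ⟨hya, hyb, hy⟩ <;>
          first | exact absurd h1 (lt_irrefl _) | (rw [hx, hy] at hlt ⊢; omega)
    · simp only [Finset.mem_filter, Finset.mem_univ, true_and]
      refine ⟨hab, ?_⟩
      simpa [h, hσ] using hw
    · simp only [Finset.mem_image, Finset.mem_filter, Finset.mem_univ, true_and, not_exists,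
        not_and]
      rintro ⟨x, y⟩ ⟨h1, h2⟩
      simp only [φ] at *
      split_ifs with hlt
      · intro he
        rw [Prod.mk.injEq] at he
        rcases hcases x with ⟨rfl, hx⟩ | ⟨rfl, hx⟩ | ⟨hxa, hxb, hx⟩ <;>
          rcases hcases y with ⟨rfl, hy⟩ | ⟨rfl, hy⟩ | ⟨hya, hyb, hy⟩ <;>
          first | exact absurd h1 (lt_irrefl _) | (rw [hx, hy] at hlt he; omega)
      · intro he
        rw [Prod.mk.injEq] at he
        obtain ⟨rfl, rfl⟩ := he
        omega
  refine lt_of_eq_of_lt (Finset.card_image_of_injOn ?_).symm (Finset.card_lt_card himg)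
  rintro ⟨x, y⟩ hxy ⟨x', y'⟩ hxy' he
  simp only [Finset.coe_filter, Finset.mem_univ, true_and, Set.mem_ofPred_eq] at hxy hxy'
  simp only [φ] at he
  split_ifs at he with h1 h2 h2
  · rw [Prod.mk.injEq] at he ⊢
    exact ⟨σ.injective he.1, σ.injective he.2⟩
  · rw [Prod.mk.injEq] at he
    rw [← he.1, ← he.2, hinv, hinv] at h2
    exact absurd hxy.1 h2
  · rw [Prod.mk.injEq] at he
    rw [he.1, he.2, hinv, hinv] at h1
    exact absurd hxy'.1 h1
  · exact he

namespace PipeDream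

open GridEdge

variable {R : Type*} [CommRing R] {k n : ℕ} {lam : BoxPartition k n}

theorem reached_of_mem {e : GridEdge} (he : e.square ∈ lam.diagram.cells) : e.Reached lam := by
  rcases e with ⟨i, j⟩ | ⟨i, j⟩
  · exact ⟨lam.row_lt _ he, Or.inr (lam.diagram.up_left_mem le_rfl (Nat.sub_le _ _) he)⟩
  · exact ⟨lam.col_lt _ he, Or.inr (lam.diagram.up_left_mem (Nat.sub_le _ _) le_rfl he)⟩

theorem reached_origin (E : PipeDream lam) {e : GridEdge} (he : e.Reached lam) :
    (E.origin e).Reached lam := by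
  have := E.apply_origin (fun e => e.Reached lam) he fun e' h _ _ =>
    propext ⟨fun _ => reached_of_mem h, fun _ => E.reached_next h⟩
  rwa [this]

/-! ### Path sums with jumps from left to top pipes -/

/-- The coefficient with which a path on the edge may jump to the other pipe: paths jump only from
the pipe on the left edge of a cell to the pipe on its top edge. -/
def jumpCoeff (γ : lam.Cell → R) : GridEdge → R
  | .left i j => if h : (i, j) ∈ lam.diagram.cells then γ ⟨(i, j), h⟩ else 0
  | .top _ _ => 0

/-- The weighted number of paths on the pipes of `E` from an edge to the sink labelled `t` that may
jump in each cell `c`, with weight `γ c`, from the pipe on the left edge to that on the top edge. -/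
def pathSum (E : PipeDream lam) (γ : lam.Cell → R) (t : ℕ) (e : GridEdge) : R :=
  if e.square ∈ lam.diagram.cells then
    E.pathSum γ t (E.next e) + jumpCoeff γ e * E.pathSum γ t (E.other e)
  else if e.position (n - k) = t then 1 else 0
termination_by k + (n - k) - (e.square.1 + e.square.2)
decreasing_by
  all_goals
    have h1 := lam.row_lt _ ‹_›
    have h2 := lam.col_lt _ ‹_›
    have h3 := sum_square_next E e
    have h4 := sum_square_other E e
    omega

theorem pathSum_of_mem (E : PipeDream lam) (γ : lam.Cell → R) (t : ℕ) {e : GridEdge}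
    (he : e.square ∈ lam.diagram.cells) :
    E.pathSum γ t e = E.pathSum γ t (E.next e) + jumpCoeff γ e * E.pathSum γ t (E.other e) := by
  rw [pathSum, if_pos he]

theorem pathSum_of_notMem (E : PipeDream lam) (γ : lam.Cell → R) (t : ℕ) {e : GridEdge}
    (he : e.square ∉ lam.diagram.cells) :
    E.pathSum γ t e = if e.position (n - k) = t then 1 else 0 := by
  rw [pathSum, if_neg he]

theorem jumpCoeff_eq_zero {γ : lam.Cell → R} {e : GridEdge}
    (h : ∀ q : lam.Cell, q.1 = e.square → γ q = 0) : jumpCoeff γ e = 0 := by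
  rcases e with ⟨i, j⟩ | ⟨i, j⟩ <;> simp only [jumpCoeff]
  split_ifs with h'
  · exact h _ rfl
  · rfl

theorem jumpCoeff_congr {γ γ' : lam.Cell → R} {e : GridEdge}
    (h : ∀ q : lam.Cell, q.1 = e.square → γ q = γ' q) : jumpCoeff γ e = jumpCoeff γ' e := by
  rcases e with ⟨i, j⟩ | ⟨i, j⟩ <;> simp only [jumpCoeff]
  split_ifs with h'
  · exact h _ rfl
  · rfl

theorem isCrossing_congr {E E' : PipeDream lam} {a : ℕ × ℕ}
    (h : ∀ q : lam.Cell, q.1 = a → (q ∈ E ↔ q ∈ E')) : E.IsCrossing a ↔ E'.IsCrossing a :=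
  exists_congr fun _ => h _ rfl

theorem next_congr {E E' : PipeDream lam} {e : GridEdge}
    (h : ∀ q : lam.Cell, q.1 = e.square → (q ∈ E ↔ q ∈ E')) : E.next e = E'.next e := by
  have := isCrossing_congr h
  rcases e with ⟨i, j⟩ | ⟨i, j⟩ <;> simp only [next, square] at * <;> simp only [this]

theorem other_congr {E E' : PipeDream lam} {e : GridEdge}
    (h : ∀ q : lam.Cell, q.1 = e.square → (q ∈ E ↔ q ∈ E')) : E.other e = E'.other e := by
  have := isCrossing_congr h
  rcases e with ⟨i, j⟩ | ⟨i, j⟩ <;> simp only [other, square] at * <;> simp only [this]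

theorem square_le_other (E : PipeDream lam) (e : GridEdge) : e.square ≤ (E.other e).square := by
  cases e <;> simp only [other] <;> split_ifs <;> simp [square, Prod.le_def]

theorem pathSum_congr {E E' : PipeDream lam} {γ γ' : lam.Cell → R} (t : ℕ) (e : GridEdge) :
    (∀ q : lam.Cell, e.square ≤ q.1 → ((q ∈ E ↔ q ∈ E') ∧ γ q = γ' q)) →
      E.pathSum γ t e = E'.pathSum γ' t e := by
  induction e using southEast_induction lam with
  | out e h => intro _; rw [E.pathSum_of_notMem γ t h, E'.pathSum_of_notMem γ' t h]
  | cell e h ih =>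
    intro hq
    rw [E.pathSum_of_mem γ t h, E'.pathSum_of_mem γ' t h,
      ← next_congr fun q hq' => (hq q hq'.ge).1, ← other_congr fun q hq' => (hq q hq'.ge).1,
      jumpCoeff_congr fun q hq' => (hq q hq'.ge).2,
      ih _ (E.level_next e) (E.square_le_next e)
        fun q h' => hq q ((E.square_le_next e).trans h'),
      ih _ (E.level_other e) (E.square_le_other e)
        fun q h' => hq q ((E.square_le_other e).trans h')]

/-- Labels are the jump-free case of path sums, so facts about path sums specialise to labels. -/
theorem pathSum_zero (E : PipeDream lam) (t : ℕ) (e : GridEdge) :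
    E.pathSum (0 : lam.Cell → R) t e = if E.label e = t then 1 else 0 := by
  induction e using southEast_induction lam with
  | out e h => rw [E.pathSum_of_notMem _ t h, E.label_of_notMem h]
  | cell e h ih =>
    rw [E.pathSum_of_mem _ t h, E.label_of_mem h,
      jumpCoeff_eq_zero (γ := (0 : lam.Cell → R)) fun _ _ => rfl, zero_mul,
      add_zero, ih _ (E.level_next e) (E.square_le_next e)]

/-- A change at the cell `c` affects only the pipes through `c`. -/
theorem pathSum_eq_of_forall_cell {E E' : PipeDream lam} {γ γ' : lam.Cell → R} {c : lam.Cell}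
    (hE : ∀ q, q ≠ c → (q ∈ E ↔ q ∈ E')) (hγ : ∀ q, q ≠ c → γ q = γ' q)
    (h0 : ∀ q : lam.Cell, q.1 < c.1 → γ q = 0) (t : ℕ) (e : GridEdge) :
    (∀ f : GridEdge, f.square = c.1 → E.origin f = E.origin e →
      E.pathSum γ t f = E'.pathSum γ' t f) → E.pathSum γ t e = E'.pathSum γ' t e := by
  induction e using southEast_induction lam with
  | out e h => intro _; rw [E.pathSum_of_notMem γ t h, E'.pathSum_of_notMem γ' t h]
  | cell e h ih =>
    intro hc
    by_cases h1 : e.square = c.1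
    · exact hc e h1 rfl
    -- North-west of `c` there are no jumps, so `c` can be met only along the pipe of `e`. From an
    -- edge whose square is not weakly north-west of `c`, the cell `c` is out of reach.
    · by_cases h2 : e.square ≤ c.1
      · have h3 := lt_of_le_of_ne h2 h1
        have hne : ∀ q : lam.Cell, q.1 = e.square → q ≠ c := by
          rintro q hq rfl
          exact h1 hq.symm
        rw [E.pathSum_of_mem γ t h, E'.pathSum_of_mem γ' t h,
          ← jumpCoeff_congr fun q hq => hγ q (hne q hq),
          jumpCoeff_eq_zero fun q hq => h0 q (by rwa [hq]),
          ← next_congr fun q hq => hE q (hne q hq), zero_mul, zero_mul, add_zero, add_zero]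
        exact ih _ (E.level_next e) (E.square_le_next e)
          fun f hf hf' => hc f hf (by rw [hf', origin_next])
      · refine pathSum_congr t e fun q hq => ?_
        have : q ≠ c := by
          rintro rfl
          exact h2 hq
        exact ⟨hE q this, hγ q this⟩

theorem pathSum_origin (E : PipeDream lam) {γ : lam.Cell → R} (t : ℕ) {e : GridEdge}
    (he : e.Reached lam) (h0 : ∀ q : lam.Cell, q.1 < e.square → γ q = 0) :
    E.pathSum γ t (E.origin e) = E.pathSum γ t e := by
  refine E.apply_origin (E.pathSum γ t) he fun e' h1 h2 h3 => ?_
  have h4 : e'.square < e.square := lt_of_le_of_ne h2 fun h4 => by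
    simp only [level, h4] at h3
    omega
  rw [E.pathSum_of_mem γ t h1, jumpCoeff_eq_zero fun q hq => h0 q (by rwa [hq]), zero_mul,
    add_zero]

/-! ### Effect of a toggle on path sums, labels and the border word -/

theorem mem_toggle_of_ne (E : PipeDream lam) {p q : lam.Cell} (h : q ≠ p) :
    q ∈ E ↔ q ∈ E.toggle p := by
  simp [toggle, Finset.mem_symmDiff, h]

theorem mem_toggle_self (E : PipeDream lam) (p : lam.Cell) : p ∈ E.toggle p ↔ p ∉ E := by
  simp [toggle, Finset.mem_symmDiff]

theorem isCrossing_cell (E : PipeDream lam) (p : lam.Cell) :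
    E.IsCrossing (p.1.1, p.1.2) ↔ p ∈ E :=
  ⟨fun ⟨_, h⟩ => h, fun h => ⟨p.2, h⟩⟩

theorem next_toggle_left (E : PipeDream lam) (p : lam.Cell) :
    (E.toggle p).next (.left p.1.1 p.1.2) = E.next (.top p.1.1 p.1.2) := by
  simp only [next, isCrossing_cell, mem_toggle_self]
  split_ifs <;> rfl

theorem next_toggle_top (E : PipeDream lam) (p : lam.Cell) :
    (E.toggle p).next (.top p.1.1 p.1.2) = E.next (.left p.1.1 p.1.2) := by
  simp only [next, isCrossing_cell, mem_toggle_self]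
  split_ifs <;> rfl

theorem other_left (E : PipeDream lam) (i j : ℕ) : E.other (.left i j) = E.next (.top i j) := rfl

theorem other_top (E : PipeDream lam) (i j : ℕ) : E.other (.top i j) = E.next (.left i j) := rfl

theorem origin_toggle (E : PipeDream lam) {p : lam.Cell} {e : GridEdge}
    (h : ¬ p.1 < e.square) : (E.toggle p).origin e = E.origin e :=
  (origin_congr e fun q hq => E.mem_toggle_of_ne <| by
    rintro rfl
    exact h hq).symm

theorem eq_left_or_eq_top {c : lam.Cell} {f : GridEdge} (h : f.square = c.1) :
    f = .left c.1.1 c.1.2 ∨ f = .top c.1.1 c.1.2 := by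
  rcases f with ⟨i, j⟩ | ⟨i, j⟩ <;> rw [← h] <;> simp [square]

theorem not_le_of_level_eq {p : lam.Cell} {e : GridEdge}
    (h : e.level = p.1.1 + p.1.2 + 1) : ¬ e.square ≤ p.1 := by
  rintro ⟨h1, h2⟩
  simp only [level] at *
  omega

theorem pathSum_toggle_next (E : PipeDream lam) {γ : lam.Cell → R} (p : lam.Cell) (t : ℕ)
    (e : GridEdge) (he : e.level = p.1.1 + p.1.2 + 1) :
    (E.toggle p).pathSum γ t e = E.pathSum γ t e := by
  refine (pathSum_congr t e fun q hq => ⟨E.mem_toggle_of_ne ?_, rfl⟩).symm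
  rintro rfl
  exact not_le_of_level_eq he hq

/-- A toggle exchanges the exits of the two pipes. The coefficient at `p` must vanish because jumps
treat the left and top edges differently. -/
theorem pathSum_toggle_left (E : PipeDream lam) {γ : lam.Cell → R} {p : lam.Cell} (hp : γ p = 0)
    (t : ℕ) : (E.toggle p).pathSum γ t (.left p.1.1 p.1.2) = E.pathSum γ t (.top p.1.1 p.1.2) := by
  rw [pathSum_of_mem (e := .left p.1.1 p.1.2) _ _ _ p.2,
    pathSum_of_mem (e := .top p.1.1 p.1.2) _ _ _ p.2, next_toggle_left,
    pathSum_toggle_next _ _ _ _ (E.level_next _)]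
  simp only [jumpCoeff, Prod.mk.eta, p.2, dif_pos, Subtype.coe_eta, hp, zero_mul]

theorem pathSum_toggle_top (E : PipeDream lam) {γ : lam.Cell → R} {p : lam.Cell} (hp : γ p = 0)
    (t : ℕ) : (E.toggle p).pathSum γ t (.top p.1.1 p.1.2) = E.pathSum γ t (.left p.1.1 p.1.2) := by
  rw [pathSum_of_mem (e := .left p.1.1 p.1.2) _ _ _ p.2,
    pathSum_of_mem (e := .top p.1.1 p.1.2) _ _ _ p.2, next_toggle_top,
    pathSum_toggle_next _ _ _ _ (E.level_next _)]
  simp only [jumpCoeff, Prod.mk.eta, p.2, dif_pos, Subtype.coe_eta, hp, zero_mul]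

theorem pathSum_toggle_of_origin_ne (E : PipeDream lam) {γ : lam.Cell → R} {p : lam.Cell}
    (h0 : ∀ q : lam.Cell, q.1 < p.1 → γ q = 0) (t : ℕ) {e : GridEdge}
    (h1 : E.origin e ≠ E.origin (.left p.1.1 p.1.2))
    (h2 : E.origin e ≠ E.origin (.top p.1.1 p.1.2)) :
    (E.toggle p).pathSum γ t e = E.pathSum γ t e := by
  refine (pathSum_eq_of_forall_cell (fun q => E.mem_toggle_of_ne) (fun _ _ => rfl) h0 t e
    fun f hf hfe => ?_).symm
  rcases eq_left_or_eq_top hf with rfl | rfl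
  · exact absurd hfe.symm h1
  · exact absurd hfe.symm h2

/-- Over `ℤ` the label is the only `t` with nonzero jump-free path sum. -/
theorem label_eq_of_pathSum_eq {E E' : PipeDream lam} {e f : GridEdge}
    (h : ∀ t, E.pathSum (0 : lam.Cell → ℤ) t e = E'.pathSum 0 t f) : E.label e = E'.label f := by
  have := h (E.label e)
  rw [pathSum_zero, pathSum_zero, if_pos rfl] at this
  by_contra hne
  rw [if_neg (Ne.symm hne)] at this
  exact one_ne_zero this

theorem label_toggle_left (E : PipeDream lam) (p : lam.Cell) :
    (E.toggle p).label (.left p.1.1 p.1.2) = E.label (.top p.1.1 p.1.2) :=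
  label_eq_of_pathSum_eq fun t => E.pathSum_toggle_left rfl t

theorem label_toggle_top (E : PipeDream lam) (p : lam.Cell) :
    (E.toggle p).label (.top p.1.1 p.1.2) = E.label (.left p.1.1 p.1.2) :=
  label_eq_of_pathSum_eq fun t => E.pathSum_toggle_top rfl t

theorem label_toggle_of_origin_ne (E : PipeDream lam) {p : lam.Cell} {e : GridEdge}
    (h1 : E.origin e ≠ E.origin (.left p.1.1 p.1.2))
    (h2 : E.origin e ≠ E.origin (.top p.1.1 p.1.2)) :
    (E.toggle p).label e = E.label e :=
  label_eq_of_pathSum_eq fun t => E.pathSum_toggle_of_origin_ne (fun _ _ => rfl) t h1 h2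

theorem label_toggle_origin_left (E : PipeDream lam) (p : lam.Cell) :
    (E.toggle p).label (E.origin (.left p.1.1 p.1.2)) =
      E.label (E.origin (.top p.1.1 p.1.2)) := by
  rw [← E.origin_toggle (lt_irrefl p.1), label_origin _ (reached_of_mem p.2),
    label_origin _ (reached_of_mem p.2), label_toggle_left]

theorem label_toggle_origin_top (E : PipeDream lam) (p : lam.Cell) :
    (E.toggle p).label (E.origin (.top p.1.1 p.1.2)) =
      E.label (E.origin (.left p.1.1 p.1.2)) := by
  rw [← E.origin_toggle (lt_irrefl p.1), label_origin _ (reached_of_mem p.2),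
    label_origin _ (reached_of_mem p.2), label_toggle_top]

theorem origin_left_ne_origin_top (E : PipeDream lam) (i j : ℕ) :
    E.origin (.left i j) ≠ E.origin (.top i j) := fun h => by
  have := E.eq_of_origin_eq (e := .left i j) (f := .top i j) rfl h
  contradiction

/-- The edges of the north-west border, in the order in which `word` reads them. -/
def borderEdge (k : ℕ) {n : ℕ} (a : Fin n) : GridEdge :=
  if (a : ℕ) < n - k then .top 0 (n - k - 1 - a) else .left (a - (n - k)) 0

theorem word_eq_label (E : PipeDream lam) (a : Fin n) : E.word a = E.label (borderEdge k a) := by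
  unfold word borderEdge
  split_ifs <;> rfl

theorem borderEdge_injective (k n : ℕ) : Function.Injective (borderEdge k : Fin n → GridEdge) := by
  intro a b h
  unfold borderEdge at h
  split_ifs at h <;> simp only [left.injEq, top.injEq] at h <;> omega

theorem origin_borderEdge (E : PipeDream lam) (a : Fin n) :
    E.origin (borderEdge k a) = borderEdge k a := by
  unfold borderEdge
  split_ifs <;> simp [origin]

theorem exists_borderEdge_eq_left (hkn : k ≤ n) {i : ℕ} (hi : i < k) :
    ∃ a : Fin n, (a : ℕ) = n - k + i ∧ borderEdge k a = .left i 0 :=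
  ⟨⟨n - k + i, by omega⟩, rfl, by simp [borderEdge]⟩

theorem exists_borderEdge_eq_top {j : ℕ} (hj : j < n - k) :
    ∃ a : Fin n, (a : ℕ) = n - k - 1 - j ∧ borderEdge k a = .top 0 j := by
  refine ⟨⟨n - k - 1 - j, by omega⟩, rfl, ?_⟩
  simp only [borderEdge]
  rw [if_pos (by omega)]
  congr 1
  omega

theorem word_toggle (E : PipeDream lam) {p : lam.Cell} {a b : Fin n}
    (ha : borderEdge k a = E.origin (.left p.1.1 p.1.2))
    (hb : borderEdge k b = E.origin (.top p.1.1 p.1.2)) (x : Fin n) :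
    (E.toggle p).word x = E.word (Equiv.swap a b x) := by
  simp only [word_eq_label]
  by_cases hxa : x = a
  · rw [hxa, Equiv.swap_apply_left, ha, hb, label_toggle_origin_left]
  · by_cases hxb : x = b
    · rw [hxb, Equiv.swap_apply_right, ha, hb, label_toggle_origin_top]
    · rw [Equiv.swap_apply_of_ne_of_ne hxa hxb]
      refine E.label_toggle_of_origin_ne ?_ ?_
      · rw [origin_borderEdge, ← ha]
        exact fun h => hxa (borderEdge_injective k n h)
      · rw [origin_borderEdge, ← hb]
        exact fun h => hxb (borderEdge_injective k n h)

theorem length_lt_toggle (E : PipeDream lam) {p : lam.Cell} {a b : Fin n} (hab : a < b)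
    (ha : borderEdge k a = E.origin (.top p.1.1 p.1.2))
    (hb : borderEdge k b = E.origin (.left p.1.1 p.1.2))
    (h : E.label (.top p.1.1 p.1.2) < E.label (.left p.1.1 p.1.2)) :
    E.length < (E.toggle p).length := by
  refine card_inversions_lt_of_swap hab ?_ fun x => by
    rw [E.word_toggle hb ha, Equiv.swap_comm]
  rwa [word_eq_label, word_eq_label, ha, hb, label_origin _ (reached_of_mem p.2),
    label_origin _ (reached_of_mem p.2)]

theorem length_toggle_lt (E : PipeDream lam) {p : lam.Cell} {a b : Fin n} (hab : a < b)
    (ha : borderEdge k a = E.origin (.left p.1.1 p.1.2))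
    (hb : borderEdge k b = E.origin (.top p.1.1 p.1.2))
    (h : E.label (.top p.1.1 p.1.2) < E.label (.left p.1.1 p.1.2)) :
    (E.toggle p).length < E.length := by
  -- The swap lemma is applied backwards, from the toggled word to the original one.
  refine card_inversions_lt_of_swap hab ?_ fun x => by
    rw [E.word_toggle ha hb, Equiv.swap_apply_self]
  rwa [word_eq_label, word_eq_label, ha, hb, label_toggle_origin_left, label_toggle_origin_top,
    label_origin _ (reached_of_mem p.2), label_origin _ (reached_of_mem p.2)]

/-! ### Togglability and toggle sets -/

/-- The pipe through the left edge of `p` starts on the west border and the pipe through the top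
edge of `p` starts on the north border. -/
def WestNorth (E : PipeDream lam) (p : lam.Cell) : Prop :=
  (∃ i, E.origin (.left p.1.1 p.1.2) = .left i 0) ∧ ∃ j, E.origin (.top p.1.1 p.1.2) = .top 0 j

theorem westNorth_congr {E E' : PipeDream lam} {p : lam.Cell}
    (h : ∀ q : lam.Cell, q.1 < p.1 → (q ∈ E ↔ q ∈ E')) : E.WestNorth p ↔ E'.WestNorth p := by
  unfold WestNorth
  rw [origin_congr (.left p.1.1 p.1.2) h, origin_congr (.top p.1.1 p.1.2) h]

theorem label_left_ne_label_top (E : PipeDream lam) (p : lam.Cell) :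
    E.label (.left p.1.1 p.1.2) ≠ E.label (.top p.1.1 p.1.2) := fun h =>
  E.origin_left_ne_origin_top _ _
    (E.origin_eq_of_label_eq (reached_of_mem p.2) (reached_of_mem p.2) h)

/-- A cell that is not a white stone is a non-inverted elbow or an inverted crossing. Tracing the
exits back to the entrances gives the same inequality in both cases; it is strict because labels are
distinct. -/
theorem IsGoDiagram.label_top_lt_label_left {D : PipeDream lam} (hD : D.IsGoDiagram)
    {p : lam.Cell} (hp : ¬ D.WhiteStone p) :
    D.label (.top p.1.1 p.1.2) < D.label (.left p.1.1 p.1.2) := by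
  have hne := D.label_left_ne_label_top p
  have h := hD p
  rw [WhiteStone] at hp
  rw [D.label_of_mem (e := .left p.1.1 p.1.2) p.2,
    D.label_of_mem (e := .top p.1.1 p.1.2) p.2] at hne ⊢
  simp only [next, isCrossing_cell, Inverted] at *
  split_ifs at * with hc
  · exact not_lt.1 (fun h' => hp ⟨hc, h'.not_gt⟩) |>.lt_of_ne hne.symm
  · exact (not_lt.1 (h hc)).lt_of_ne hne.symm

end PipeDream

namespace PipeDream

open GridEdge

variable {R : Type*} [CommRing R] {k n : ℕ} {lam : BoxPartition k n}

theorem togglable_iff (hkn : k ≤ n) {D E : PipeDream lam} (hD : D.IsGoDiagram) {p : lam.Cell}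
    (hw : ¬ D.WhiteStone p)
    (hT : ∀ q ∈ toggledCells D E, ¬ (p.1.1 ≤ q.1.1 ∧ p.1.2 ≤ q.1.2)) :
    Togglable D E p ↔ E.WestNorth p := by
  have hsame : ∀ q : lam.Cell, p.1 ≤ q.1 → (q ∈ D ↔ q ∈ E) := by
    intro q hq
    have := mt (hT q) (not_not.2 hq)
    rw [toggledCells, Finset.mem_symmDiff] at this
    tauto
  have hlt : E.label (.top p.1.1 p.1.2) < E.label (.left p.1.1 p.1.2) := by
    rw [← label_congr (.top p.1.1 p.1.2) hsame, ← label_congr (.left p.1.1 p.1.2) hsame]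
    exact hD.label_top_lt_label_left hw
  have hL := E.reached_origin (reached_of_mem (e := .left p.1.1 p.1.2) p.2)
  have hR := E.reached_origin (reached_of_mem (e := .top p.1.1 p.1.2) p.2)
  constructor
  · intro h
    obtain ⟨i, hi, j, hj, h1, h2⟩ := h.swap
    have hri : (GridEdge.left i 0).Reached lam := ⟨hi, Or.inl rfl⟩
    have hrj : (GridEdge.top 0 j).Reached lam := ⟨hj, Or.inl rfl⟩
    have hoi : E.origin (.left i 0) = .left i 0 := by simp [origin]
    have hoj : E.origin (.top 0 j) = .top 0 j := by simp [origin]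
    have hne : E.label (.left i 0) ≠ E.label (.top 0 j) := by
      intro h
      have := E.origin_eq_of_label_eq hri hrj h
      simp [origin] at this
    have hi' : E.origin (.left p.1.1 p.1.2) = .left i 0 ∨
        E.origin (.top p.1.1 p.1.2) = .left i 0 := by
      -- A border pipe that avoids `p` keeps its label, yet the swap requires it to change.
      by_contra! hcon
      rw [E.label_toggle_of_origin_ne (by rw [hoi]; exact hcon.1.symm)
        (by rw [hoi]; exact hcon.2.symm)] at h1
      exact hne h1
    have hj' : E.origin (.left p.1.1 p.1.2) = .top 0 j ∨
        E.origin (.top p.1.1 p.1.2) = .top 0 j := by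
      by_contra! hcon
      rw [E.label_toggle_of_origin_ne (by rw [hoj]; exact hcon.1.symm)
        (by rw [hoj]; exact hcon.2.symm)] at h2
      exact hne h2.symm
    rcases hi' with hi' | hi' <;> rcases hj' with hj' | hj'
    · rw [hi'] at hj'; contradiction
    · exact ⟨⟨i, hi'⟩, j, hj'⟩
    -- The reversed configuration is excluded by length: the north border is read before the west,
    -- so the toggle would remove inversions.
    · obtain ⟨b, hb, hb'⟩ := exists_borderEdge_eq_left hkn hi
      obtain ⟨a, ha, ha'⟩ := exists_borderEdge_eq_top hj
      have := E.length_toggle_lt (p := p) (a := a) (b := b) (Fin.lt_def.2 (by omega))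
        (by rw [ha', hj']) (by rw [hb', hi']) hlt
      exact absurd h.length_lt this.not_gt
    · rw [hi'] at hj'; contradiction
  · rintro ⟨⟨i, hi⟩, j, hj⟩
    rw [hi] at hL
    rw [hj] at hR
    obtain ⟨b, hb, hb'⟩ := exists_borderEdge_eq_left hkn hL.1
    obtain ⟨a, ha, ha'⟩ := exists_borderEdge_eq_top hR.1
    have hR1 := hR.1
    refine ⟨hw, ⟨i, hL.1, j, hR.1, ?_, ?_⟩, ?_, hT⟩
    · rw [← hi, ← hj, label_toggle_origin_left]
    · rw [← hi, ← hj, label_toggle_origin_top]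
    · exact E.length_lt_toggle (a := a) (b := b) (Fin.lt_def.2 (by omega)) (by rw [ha', hj])
        (by rw [hb', hi]) hlt

/-- After all cells of `T` have been toggled in `E`, the pipes that enter a cell of `T` from the
left start on the west border, and those that enter from the top start on the north border. -/
def IsToggleSet (E : PipeDream lam) (T : Finset lam.Cell) : Prop :=
  ∀ c ∈ T, (symmDiff E T).WestNorth c

theorem toggle_eq_symmDiff_insert {D : PipeDream lam} {T : Finset lam.Cell} {p : lam.Cell}
    (hp : p ∉ T) : (symmDiff D T).toggle p = symmDiff D (insert p T) := by
  ext q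
  simp only [toggle, Finset.mem_symmDiff, Finset.mem_singleton, Finset.mem_insert]
  by_cases h : q = p
  · subst h; tauto
  · tauto

theorem toggledCells_symmDiff (D : PipeDream lam) (T : Finset lam.Cell) :
    toggledCells D (symmDiff D T) = T :=
  symmDiff_symmDiff_cancel_left D T

theorem symmDiff_toggledCells (D E : PipeDream lam) : symmDiff D (toggledCells D E) = E :=
  symmDiff_symmDiff_cancel_left D E

/-- A new toggle is never weakly north-west of an old one, so it leaves the origins at the cells
already toggled unchanged. -/
theorem IsRestrictedDiagram.isToggleSet (hkn : k ≤ n) {D E : PipeDream lam} (hD : D.IsGoDiagram)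
    (h : IsRestrictedDiagram D E) :
    (∀ c ∈ toggledCells D E, ¬ D.WhiteStone c) ∧ D.IsToggleSet (toggledCells D E) := by
  unfold IsToggleSet
  rw [symmDiff_toggledCells]
  induction h with
  | base => simp [toggledCells_self]
  | @step E p hE hp ih =>
    rw [toggledCells_toggle hp]
    refine ⟨?_, ?_⟩
    · intro c hc
      rcases Finset.mem_insert.1 hc with rfl | hc
      · exact hp.not_white
      · exact ih.1 c hc
    · intro c hc
      have key : ¬ p.1 < c.1 → E.WestNorth c → (E.toggle p).WestNorth c := fun h1 h2 =>
        (westNorth_congr fun q hq => E.mem_toggle_of_ne (by rintro rfl; exact h1 hq)).1 h2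
      rcases Finset.mem_insert.1 hc with rfl | hc
      · exact key (lt_irrefl _) ((togglable_iff hkn hD hp.not_white hp.not_toggled).1 hp)
      · exact key (fun h => hp.not_toggled c hc h.le) (ih.2 c hc)

/-- Toggling by increasing antidiagonal is admissible: a cell on the last antidiagonal has no other
cell of `T` weakly south-east of it. -/
theorem IsToggleSet.isRestrictedDiagram (hkn : k ≤ n) {D : PipeDream lam} (hD : D.IsGoDiagram)
    (T : Finset lam.Cell) : (∀ c ∈ T, ¬ D.WhiteStone c) → D.IsToggleSet T →
      IsRestrictedDiagram D (symmDiff D T) := by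
  induction T using Finset.induction_on_max_value (fun c : lam.Cell => c.1.1 + c.1.2) with
  | empty =>
    intro _ _
    rw [show symmDiff D (∅ : Finset lam.Cell) = D from symmDiff_bot D]
    exact .base
  | insert p T hp hmax ih =>
    intro hw hT
    have hnot : ∀ q ∈ T, ¬ p.1 ≤ q.1 := by
      intro q hq hpq
      have h1 := hmax q hq
      have h2 : p.1.1 ≤ q.1.1 := hpq.1
      have h3 : p.1.2 ≤ q.1.2 := hpq.2
      have : p = q := Subtype.ext (Prod.ext (by omega) (by omega))
      exact hp (this ▸ hq)
    have key : ∀ c : lam.Cell, ¬ p.1 < c.1 → (symmDiff D (insert p T)).WestNorth c →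
        (symmDiff D T).WestNorth c := by
      intro c hc h
      rw [← toggle_eq_symmDiff_insert hp] at h
      exact (westNorth_congr fun q hq =>
        mem_toggle_of_ne _ (by rintro rfl; exact hc hq)).2 h
    rw [← toggle_eq_symmDiff_insert hp]
    refine .step (ih (fun c hc => hw c (Finset.mem_insert_of_mem hc)) fun c hc =>
      key c (fun h => hnot c hc h.le) (hT c (Finset.mem_insert_of_mem hc))) ?_
    refine (togglable_iff hkn hD (hw p (Finset.mem_insert_self _ _)) ?_).2
      (key p (lt_irrefl _) (hT p (Finset.mem_insert_self _ _)))
    rw [toggledCells_symmDiff]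
    exact hnot

/-! ### Expansion of the determinant -/

/-- The square matrix of the path sums from the west border to the sinks `o`. -/
def pathSumMatrix (E : PipeDream lam) (γ : lam.Cell → R) (o : Fin k → ℕ) :
    Matrix (Fin k) (Fin k) R :=
  Matrix.of fun s t => E.pathSum γ (o t) (.left (s : ℕ) 0)

open Classical in
/-- Expansion of the determinant at a single cell. -/
theorem det_pathSumMatrix_of_eq_off (E : PipeDream lam) {γ γ' : lam.Cell → R} {c : lam.Cell}
    (h0 : ∀ q : lam.Cell, q.1 ≤ c.1 → γ q = 0) (h : ∀ q, q ≠ c → γ q = γ' q)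
    (o : Fin k → ℕ) :
    (E.pathSumMatrix γ' o).det = (E.pathSumMatrix γ o).det +
      if E.WestNorth c then γ' c * ((E.toggle c).pathSumMatrix γ o).det else 0 := by
  have hlt : ∀ q : lam.Cell, q.1 < c.1 → γ q = 0 := fun q hq => h0 q hq.le
  have hlt' : ∀ q : lam.Cell, q.1 < c.1 → γ' q = 0 := fun q hq => by
    rw [← h q (by rintro rfl; exact lt_irrefl _ hq), hlt q hq]
  have hLr : (GridEdge.left c.1.1 c.1.2).Reached lam := reached_of_mem c.2
  have hTr : (GridEdge.top c.1.1 c.1.2).Reached lam := reached_of_mem c.2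
  have hnext : ∀ t e, e.level = c.1.1 + c.1.2 + 1 → E.pathSum γ t e = E.pathSum γ' t e := by
    intro t e he
    refine pathSum_congr t e fun q hq => ⟨Iff.rfl, h q ?_⟩
    rintro rfl
    exact not_le_of_level_eq he hq
  have htop : ∀ t, E.pathSum γ t (.top c.1.1 c.1.2) = E.pathSum γ' t (.top c.1.1 c.1.2) := by
    intro t
    rw [pathSum_of_mem _ _ _ (e := .top c.1.1 c.1.2) c.2,
      pathSum_of_mem _ _ _ (e := .top c.1.1 c.1.2) c.2, hnext t _ (E.level_next _)]
    simp [jumpCoeff]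
  have hcc : γ c = 0 := h0 c le_rfl
  have hleft : ∀ t, E.pathSum γ' t (.left c.1.1 c.1.2) =
      E.pathSum γ t (.left c.1.1 c.1.2) + γ' c * E.pathSum γ t (.top c.1.1 c.1.2) := by
    intro t
    rw [pathSum_of_mem _ _ _ (e := .top c.1.1 c.1.2) c.2,
      pathSum_of_mem _ _ _ (e := .left c.1.1 c.1.2) c.2,
      pathSum_of_mem _ _ _ (e := .left c.1.1 c.1.2) c.2, other_left,
      hnext t _ (E.level_next _), hnext t _ (E.level_next _)]
    simp [jumpCoeff, c.2, hcc]
  -- Jumps leave only from left edges, so a pipe that avoids `c` or enters it from the top does not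
  -- feel the new parameter.
  have hoth : ∀ t (s : ℕ), E.origin (.left c.1.1 c.1.2) ≠ .left s 0 →
      E.pathSum γ' t (.left s 0) = E.pathSum γ t (.left s 0) := by
    intro t s hs
    refine (pathSum_eq_of_forall_cell (c := c) (fun _ _ => Iff.rfl) h hlt t _
      fun f hf hfe => ?_).symm
    rcases eq_left_or_eq_top hf with rfl | rfl
    · exact absurd (by rw [hfe, origin]) hs
    · exact htop t
  rcases E.origin_isBorder (.left c.1.1 c.1.2) with ⟨i, hi⟩ | ⟨j, hj⟩
  swap
  · have hW : ¬ E.WestNorth c := by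
      rintro ⟨⟨i, hi⟩, _⟩
      rw [hj] at hi
      contradiction
    rw [if_neg hW, add_zero]
    congr 1
    ext s t
    exact hoth _ _ (by rw [hj]; simp)
  have hik : i < k := by
    have := E.reached_origin hLr
    rw [hi] at this
    exact this.1
  set M := E.pathSumMatrix γ o with hM
  set v : Fin k → R := fun t => E.pathSum γ (o t) (.top c.1.1 c.1.2) with hv
  let s₀ : Fin k := ⟨i, hik⟩
  have hrow : E.pathSumMatrix γ' o = M.updateRow s₀ (M s₀ + γ' c • v) := by
    ext s t
    by_cases hs : s = s₀
    · subst hs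
      rw [Matrix.updateRow_self]
      simp only [pathSumMatrix, Matrix.of_apply, hM, hv, Pi.add_apply, Pi.smul_apply, smul_eq_mul,
        s₀]
      rw [← hi, E.pathSum_origin _ hLr hlt,
        E.pathSum_origin _ hLr hlt', hleft]
    · rw [Matrix.updateRow_ne hs]
      refine hoth _ _ ?_
      rw [hi]
      intro he
      rw [left.injEq] at he
      exact hs (Fin.ext he.1.symm)
  rw [hrow, Matrix.det_updateRow_add, Matrix.updateRow_eq_self, Matrix.det_updateRow_smul]
  congr 1
  -- The new row `v` is the path-sum row of the top pipe. It repeats another row if that pipe starts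
  -- on the west border; otherwise it is the row that toggling `c` produces.
  rcases E.origin_isBorder (.top c.1.1 c.1.2) with ⟨i', hi'⟩ | ⟨j, hj⟩
  · have hW : ¬ E.WestNorth c := by
      rintro ⟨_, j, hj⟩
      rw [hj] at hi'
      contradiction
    have hik' : i' < k := by
      have := E.reached_origin hTr
      rw [hi'] at this
      exact this.1
    have hne : s₀ ≠ ⟨i', hik'⟩ := by
      intro he
      apply E.origin_left_ne_origin_top c.1.1 c.1.2
      rw [hi, hi', show i = i' from congrArg Fin.val he]
    rw [if_neg hW, Matrix.det_zero_of_row_eq hne, mul_zero]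
    rw [Matrix.updateRow_self, Matrix.updateRow_ne hne.symm]
    ext t
    simp only [hM, hv, pathSumMatrix, Matrix.of_apply]
    rw [← hi', E.pathSum_origin _ hTr hlt]
  · rw [if_pos ⟨⟨i, hi⟩, j, hj⟩]
    congr 2
    ext s t
    by_cases hs : s = s₀
    · subst hs
      rw [Matrix.updateRow_self]
      simp only [pathSumMatrix, Matrix.of_apply, hv, s₀]
      rw [← hi, ← E.origin_toggle (lt_irrefl c.1), pathSum_origin _ _ hLr hlt,
        E.pathSum_toggle_left hcc]
    · rw [Matrix.updateRow_ne hs]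
      refine (E.pathSum_toggle_of_origin_ne hlt _ ?_ ?_).symm
      · rw [hi, origin, Ne, left.injEq]
        exact fun he => hs (Fin.ext he.1)
      · rw [hj, origin]
        simp

open Classical in
-- No cell of `U` is weakly north-west of `c`, so the origins at `c` are those in `E`. The remaining
-- conditions concern one and the same final diagram.
theorem isToggleSet_insert_iff {E : PipeDream lam} {U T : Finset lam.Cell} {c : lam.Cell}
    (hU : ∀ q ∈ U, ¬ q.1 ≤ c.1) (hT : T ⊆ U) :
    E.IsToggleSet (insert c T) ↔ E.WestNorth c ∧ (E.toggle c).IsToggleSet T := by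
  have hc : c ∉ T := fun h => hU c (hT h) le_rfl
  have heq : symmDiff (E.toggle c) T = symmDiff E (insert c T) := by
    rw [← toggle_eq_symmDiff_insert hc, toggle, toggle, symmDiff_right_comm]
  have hWN : (symmDiff E (insert c T)).WestNorth c ↔ E.WestNorth c := by
    refine westNorth_congr fun q hq => ?_
    have h1 : q ≠ c := by rintro rfl; exact lt_irrefl _ hq
    have h2 : q ∉ T := fun h => hU q (hT h) hq.le
    simp [Finset.mem_symmDiff, h1, h2]
  unfold IsToggleSet
  rw [Finset.forall_mem_insert, hWN, heq]

open Classical in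
/-- Expansion of the determinant over all toggle sets. -/
theorem det_pathSumMatrix_eq_sum (γ : lam.Cell → R) (o : Fin k → ℕ) (U : Finset lam.Cell) :
    ∀ E : PipeDream lam, (E.pathSumMatrix (fun c => if c ∈ U then γ c else 0) o).det =
      ∑ T ∈ U.powerset, if E.IsToggleSet T then
        (∏ c ∈ T, γ c) * ((symmDiff E T).pathSumMatrix 0 o).det else 0 := by
  -- The order dual makes the inserted `c` minimal in level, so all parameters of `U` weakly
  -- north-west of it are off, as the one-cell expansion requires.
  induction U using Finset.induction_on_max_value
    (fun c : lam.Cell => OrderDual.toDual (c.1.1 + c.1.2)) with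
  | empty =>
    intro E
    have h1 : E.IsToggleSet ∅ := fun c hc => by simp at hc
    have h2 : symmDiff E (∅ : Finset lam.Cell) = E := symmDiff_bot E
    simp [h1, h2]
    rfl
  | insert c U hc hmax ih =>
    intro E
    have hnot : ∀ q ∈ U, ¬ q.1 ≤ c.1 := by
      intro q hq hqc
      have h1 : c.1.1 + c.1.2 ≤ q.1.1 + q.1.2 := hmax q hq
      have h2 : q.1.1 ≤ c.1.1 := hqc.1
      have h3 : q.1.2 ≤ c.1.2 := hqc.2
      have : c = q := Subtype.ext (Prod.ext (by omega) (by omega))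
      exact hc (this ▸ hq)
    rw [E.det_pathSumMatrix_of_eq_off (c := c) (γ := fun q => if q ∈ U then γ q else 0)
      (fun q hq => if_neg fun h => hnot q h hq) (fun q hq => by simp [hq]), ih, ih,
      Finset.sum_powerset_insert hc]
    congr 1
    have hterm : ∀ T ∈ U.powerset, (if E.IsToggleSet (insert c T) then
        (∏ q ∈ insert c T, γ q) * ((symmDiff E (insert c T)).pathSumMatrix 0 o).det else 0) =
        if E.WestNorth c then γ c * (if (E.toggle c).IsToggleSet T then
          (∏ q ∈ T, γ q) * ((symmDiff (E.toggle c) T).pathSumMatrix 0 o).det else 0) else 0 := by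
      intro T hT
      have hT := Finset.mem_powerset.1 hT
      have hcT : c ∉ T := fun h => hc (hT h)
      rw [← toggle_eq_symmDiff_insert hcT, Finset.prod_insert hcT, toggle, toggle,
        symmDiff_right_comm]
      simp only [isToggleSet_insert_iff hnot hT, toggle]
      split_ifs <;> simp_all [mul_assoc]
    rw [Finset.sum_congr rfl hterm]
    simp only [Finset.mem_insert_self, if_true]
    by_cases hW : E.WestNorth c
    · simp only [if_pos hW, Finset.mul_sum]
    · simp only [if_neg hW]
      exact Finset.sum_const_zero.symm

end PipeDream

namespace PipeDream

open GridEdge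

variable {R : Type*} [CommRing R] {k n : ℕ} {lam : BoxPartition k n}

/-! ### Restricted paths as path sums -/

theorem finsum_weight_of_notMem {D : PipeDream lam} (β : lam.Cell → R) (t : ℕ) {e : GridEdge}
    (he : e.square ∉ lam.diagram.cells) :
    ∑ᶠ P : RestrictedPath D t e, P.weight β = if e.position (n - k) = t then 1 else 0 := by
  split_ifs with ht
  · have hu : ∀ P : RestrictedPath D t e, P = .arrive he ht := by
      intro P
      cases P with
      | arrive => rfl
      | follow h => exact absurd h he
      | jump h => exact absurd h he
    rw [finsum_eq_single _ (.arrive he ht) fun P hP => absurd (hu P) hP]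
    rfl
  · have : IsEmpty (RestrictedPath D t e) := ⟨fun P => by
      cases P with
      | arrive _ h => exact ht h
      | follow h => exact he h
      | jump h => exact he h⟩
    exact finsum_of_isEmpty _

theorem finsum_weight_of_not_jump {D : PipeDream lam} (β : lam.Cell → R) (t : ℕ) {e : GridEdge}
    (he : e.square ∈ lam.diagram.cells)
    (hj : ¬ (¬ D.WhiteStone ⟨e.square, he⟩ ∧ D.label (D.other e) < D.label e)) :
    ∑ᶠ P : RestrictedPath D t e, P.weight β =
      ∑ᶠ P : RestrictedPath D t (D.next e), P.weight β := by
  have hbij : Function.Bijective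
      (RestrictedPath.follow he : RestrictedPath D t (D.next e) → RestrictedPath D t e) := by
    refine ⟨fun P Q h => by injection h, fun P => ?_⟩
    cases P with
    | arrive h => exact absurd he h
    | follow _ P => exact ⟨P, rfl⟩
    | jump _ hw hl => exact absurd ⟨hw, hl⟩ hj
  exact (finsum_eq_of_bijective _ hbij fun _ => rfl).symm

theorem finsum_weight_of_jump {D : PipeDream lam} (β : lam.Cell → R) (t : ℕ) {e : GridEdge}
    (he : e.square ∈ lam.diagram.cells) (hw : ¬ D.WhiteStone ⟨e.square, he⟩)
    (hl : D.label (D.other e) < D.label e) :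
    ∑ᶠ P : RestrictedPath D t e, P.weight β =
      ∑ᶠ P : RestrictedPath D t (D.next e), P.weight β +
        β ⟨e.square, he⟩ * ∑ᶠ P : RestrictedPath D t (D.other e), P.weight β := by
  have hbij : Function.Bijective (Sum.elim (RestrictedPath.follow he)
      (RestrictedPath.jump he hw hl) :
      RestrictedPath D t (D.next e) ⊕ RestrictedPath D t (D.other e) → RestrictedPath D t e) := by
    refine ⟨?_, fun P => ?_⟩
    · rintro (P | P) (Q | Q) h <;> simp only [Sum.elim_inl, Sum.elim_inr] at h <;> injection h
      all_goals simp_all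
    · cases P with
      | arrive h => exact absurd he h
      | follow _ P => exact ⟨.inl P, rfl⟩
      | jump _ _ _ P => exact ⟨.inr P, rfl⟩
  rw [← finsum_eq_of_bijective _ hbij fun _ => rfl]
  have := Fintype.ofFinite (RestrictedPath D t (D.next e))
  have := Fintype.ofFinite (RestrictedPath D t (D.other e))
  rw [finsum_eq_sum_of_fintype, finsum_eq_sum_of_fintype, finsum_eq_sum_of_fintype,
    Fintype.sum_sum_type, Finset.mul_sum]
  rfl

open Classical in
/-- In a Go-diagram, restricted paths jump from the left to the top edges of the cells that are not
white stones. -/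
theorem IsGoDiagram.finsum_weight {D : PipeDream lam} (hD : D.IsGoDiagram) (β : lam.Cell → R)
    (t : ℕ) (e : GridEdge) :
    ∑ᶠ P : RestrictedPath D t e, P.weight β =
      D.pathSum (fun c => if D.WhiteStone c then 0 else β c) t e := by
  induction e using southEast_induction lam with
  | out e h => rw [finsum_weight_of_notMem β t h, D.pathSum_of_notMem _ t h]
  | cell e h ih =>
    rw [D.pathSum_of_mem _ t h, ← ih _ (D.level_next e) (D.square_le_next e),
      ← ih _ (D.level_other e) (D.square_le_other e)]
    by_cases hw : D.WhiteStone ⟨e.square, h⟩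
    · rw [finsum_weight_of_not_jump β t h fun h' => h'.1 hw, jumpCoeff_eq_zero, zero_mul, add_zero]
      intro q hq
      rw [if_pos (by rwa [show q = ⟨e.square, h⟩ from Subtype.ext hq])]
    · have hlt := hD.label_top_lt_label_left hw
      rcases e with ⟨i, j⟩ | ⟨i, j⟩
      · have hl : D.label (D.other (.left i j)) < D.label (.left i j) := by
          rw [other_left, ← D.label_of_mem (e := .top i j) h]
          exact hlt
        rw [finsum_weight_of_jump β t h hw hl]
        have h' : (i, j) ∈ lam.diagram.cells := h
        have hw' : ¬ D.WhiteStone ⟨(i, j), h'⟩ := hw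
        simp only [jumpCoeff, dif_pos h', if_neg hw']
        rfl
      -- On a top edge the other pipe has the larger label, which matches the zero value of
      -- `jumpCoeff` there.
      · have hl : ¬ D.label (D.other (.top i j)) < D.label (.top i j) := by
          rw [other_top, ← D.label_of_mem (e := .left i j) h]
          exact hlt.not_gt
        rw [finsum_weight_of_not_jump β t h fun h' => hl h'.2]
        simp [jumpCoeff]

/-! ### Jump-free determinants and conclusion -/

theorem westLabels_injective (hkn : k ≤ n) (E : PipeDream lam) :
    Function.Injective (E.westLabels hkn) := by
  intro s s' h
  have h1 : E.label (.left s 0) = E.label (.left s' 0) := congrArg Fin.val h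
  have h2 := E.origin_eq_of_label_eq (e := .left s 0) (f := .left s' 0)
    ⟨s.2, Or.inl rfl⟩ ⟨s'.2, Or.inl rfl⟩ h1
  simp only [origin, left.injEq] at h2
  exact Fin.ext h2.1

/-- Row `s` has a 1 exactly where the column label is the west label in row `s`. If the labels form
`I`, this is the permutation matrix of the inverse of `sortPerm`, which has the same sign; otherwise
some row is zero. -/
theorem det_pathSumMatrix_zero (hkn : k ≤ n) (E : PipeDream lam) (I : Finset (Fin n))
    (hI : I.card = k) :
    (E.pathSumMatrix (0 : lam.Cell → R) fun s => (I.orderEmbOfFin hI s : Fin n)).det =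
      if E.westSet hkn = I then ((Equiv.Perm.sign (E.sortPerm hkn) : ℤ) : R) else 0 := by
  have hM : ∀ s t, E.pathSumMatrix (0 : lam.Cell → R)
      (fun s => (I.orderEmbOfFin hI s : Fin n)) s t =
      if E.westLabels hkn s = I.orderEmbOfFin hI t then 1 else 0 := by
    intro s t
    rw [pathSumMatrix, Matrix.of_apply, pathSum_zero]
    exact if_congr (Fin.ext_iff (a := E.westLabels hkn s)).symm rfl rfl
  split_ifs with h
  · have hmono : StrictMono (E.westLabels hkn ∘ E.sortPerm hkn) :=
      (Tuple.monotone_sort _).strictMono_of_injective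
        ((E.westLabels_injective hkn).comp (E.sortPerm hkn).injective)
    have heq := Finset.orderEmbOfFin_unique hI (f := E.westLabels hkn ∘ E.sortPerm hkn)
      (fun x => by rw [← h]; exact Finset.mem_image_of_mem _ (Finset.mem_univ _)) hmono
    have hperm : E.pathSumMatrix (0 : lam.Cell → R) (fun s => (I.orderEmbOfFin hI s : Fin n)) =
        ((E.sortPerm hkn)⁻¹.toPEquiv.toMatrix : Matrix (Fin k) (Fin k) R) := by
      ext s t
      rw [hM, ← heq, PEquiv.toMatrix_apply]
      refine if_congr ?_ rfl rfl
      rw [Function.comp_apply, (E.westLabels_injective hkn).eq_iff, Equiv.toPEquiv_apply,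
        Option.mem_def, Option.some.injEq, Equiv.Perm.inv_eq_iff_eq]
    rw [hperm, Matrix.det_permutation, Equiv.Perm.sign_inv]
  · obtain ⟨s, hs⟩ : ∃ s, E.westLabels hkn s ∉ I := by
      by_contra! hcon
      refine h (Finset.eq_of_subset_of_card_le ?_ ?_)
      · intro x hx
        obtain ⟨s, _, rfl⟩ := Finset.mem_image.1 hx
        exact hcon s
      · rw [westSet, Finset.card_image_of_injective _ (E.westLabels_injective hkn), hI]
        simp
    refine Matrix.det_eq_zero_of_row_eq_zero s fun t => ?_
    rw [hM, if_neg]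
    intro he
    exact hs (he ▸ I.orderEmbOfFin_mem hI t)

theorem mem_restrictedDiagrams_iff (hkn : k ≤ n) {D : PipeDream lam} (hD : D.IsGoDiagram)
    (T : Finset lam.Cell) : symmDiff D T ∈ D.restrictedDiagrams ↔
      (∀ c ∈ T, ¬ D.WhiteStone c) ∧ D.IsToggleSet T := by
  simp only [restrictedDiagrams, Finset.mem_filter, Finset.mem_univ, true_and]
  constructor
  · intro h
    have := h.isToggleSet hkn hD
    rwa [toggledCells_symmDiff] at this
  · exact fun h => IsToggleSet.isRestrictedDiagram hkn hD T h.1 h.2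

end PipeDream

theorem mainTheorem5 {R : Type*} [CommRing R] {k n : ℕ} (hkn : k ≤ n) (lam : BoxPartition k n)
    (D : PipeDream lam) (hD : D.IsGoDiagram) (β : lam.Cell → R)
    (I : Finset (Fin n)) (hI : I.card = k) :
    pluckerCoordinate (D.restrictedPathMatrix β) I hI =
      ∑ E ∈ D.restrictedDiagrams with E.westSet hkn = I,
        ((Equiv.Perm.sign (E.sortPerm hkn) : ℤ) : R) * D.diagramWeight β E := by
  classical
  set γ : lam.Cell → R := fun c => if D.WhiteStone c then 0 else β c with hγ
  have hmat : (D.restrictedPathMatrix β).submatrix id (I.orderEmbOfFin hI) =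
      D.pathSumMatrix (fun c => if c ∈ Finset.univ then γ c else 0)
        fun s => (I.orderEmbOfFin hI s : Fin n) := by
    ext s t
    simp only [Finset.mem_univ, if_true]
    exact hD.finsum_weight β _ _
  rw [pluckerCoordinate, hmat, PipeDream.det_pathSumMatrix_eq_sum, Finset.powerset_univ,
    Finset.sum_filter, PipeDream.restrictedDiagrams, Finset.sum_filter]
  -- Symmetric difference with `D` matches sets of toggled cells with diagrams.
  refine Finset.sum_bij' (fun T _ => symmDiff D T) (fun E _ => symmDiff D E)
    (fun _ _ => Finset.mem_univ _) (fun _ _ => Finset.mem_univ _)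
    (fun T _ => symmDiff_symmDiff_cancel_left D T) (fun E _ => symmDiff_symmDiff_cancel_left D E)
    fun T _ => ?_
  have hmem := PipeDream.mem_restrictedDiagrams_iff hkn hD T
  simp only [PipeDream.restrictedDiagrams, Finset.mem_filter, Finset.mem_univ, true_and] at hmem
  rw [PipeDream.det_pathSumMatrix_zero hkn, PipeDream.diagramWeight,
    PipeDream.toggledCells_symmDiff]
  simp only [hmem]
  by_cases hw : ∀ c ∈ T, ¬ D.WhiteStone c
  · have hprod : ∏ c ∈ T, γ c = ∏ c ∈ T, β c :=
      Finset.prod_congr rfl fun c hc => if_neg (hw c hc)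
    rw [hprod]
    split_ifs <;> simp_all [mul_comm]
  -- A toggle set containing a white stone carries a zero factor, and its diagram is not restricted.
  · have hprod : ∏ c ∈ T, γ c = 0 := by
      push Not at hw
      obtain ⟨c, hc, hcw⟩ := hw
      exact Finset.prod_eq_zero hc (if_pos hcw)
    have hn : ¬ ((∀ c ∈ T, ¬ D.WhiteStone c) ∧ D.IsToggleSet T) := fun h => hw h.1
    rw [hprod, if_neg hn, zero_mul, ite_self]
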